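/- Let $n\ge 0$, let $(N,g)$ be a smooth finite-dimensional Riemannian manifold without boundary and let $V\colon N\to\mathbb{R}$ be a smooth function. Let $\phi\colon\mathbb{R}^n\to N$ be a smooth harmonic map with potential $V$, that is, a smooth map satisfying \[ \tau(\phi)=-\nabla V(\phi), \] where $\nabla V$ is the Riemannian gradient of $V$ and $\tau(\phi)=\operatorname{tr}\nabla d\phi$ is the tension field of $\phi$, given in local coordinates of $N$ by $\tau(\phi)^k=\Delta\phi^k+\sum_{i=1}^n\sum_{a,b}\Gamma^k_{ab}(\phi)\,\partial_i\phi^a\,\partial_i\phi^b$ with the Christoffel symbols $\Gamma^k_{ab}$ of the Levi-Civita connection of $g$. Write $|d\phi|^2=\sum_{i=1}^n g(\partial_i\phi,\partial_i\phi)$ and let $B_r(x)$ be the open Euclidean ball of radius $r$ around $x\in\mathbb{R}^n$. Suppose that $V(\phi(y))\le 0$ for all $y\in\mathbb{R}^n$. Then for every $x\in\mathbb{R}^n$ the function \[ r\longmapsto \frac{1}{r^{n-2}}\int_{B_r(x)}\Big(\frac12|d\phi|^2-V(\phi)\Big)\,dy \] is well defined (the integrand is integrable on $B_r(x)$) and differentiable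 on $(0,\infty)$, and \[ \frac{d}{dr}\,\frac{1}{r^{n-2}}\int_{B_r(x)}\Big(\frac12|d\phi|^2-V(\phi)\Big)\,dy\ \ge\ 0\qquad\text{for all } r>0. \] In particular this function is nondecreasing on $(0,\infty)$. -/

import Mathlib

open scoped Manifold ContDiff

noncomputable section

/-- Euclidean space `ℝᵏ` with its standard inner product. -/
abbrev Euc (k : ℕ) : Type := EuclideanSpace ℝ (Fin k)

/-- The `i`-th standard basis vector of `ℝᵏ`. -/
abbrev stdVec {k : ℕ} (i : Fin k) : Euc k := EuclideanSpace.single i (1 : ℝ)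

/-- A smooth Riemannian metric on an `m`-dimensional smooth manifold `N` (without boundary). -/
abbrev SmoothMetric (m : ℕ) (N : Type*) [TopologicalSpace N] [ChartedSpace (Euc m) N]
    [IsManifold (𝓡 m) ∞ N] :=
  Bundle.ContMDiffRiemannianMetric (𝓡 m) ∞ (Euc m) (fun y : N => TangentSpace (𝓡 m) y)

namespace HarmonicMap

section Target

variable {m : ℕ} {N : Type*} [TopologicalSpace N] [ChartedSpace (Euc m) N]
  [IsManifold (𝓡 m) ∞ N]

/-- The coordinate vector field `∂_i` of the preferred chart at `y`, at the point of `N` with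
coordinates `u`. -/
def coordVec (y : N) (u : Euc m) (i : Fin m) :
    TangentSpace (𝓡 m) ((extChartAt (𝓡 m) y).symm u) :=
  mfderiv 𝓘(ℝ, Euc m) (𝓡 m) (extChartAt (𝓡 m) y).symm u (stdVec i)

/-- The matrix `g_{ij} = g(∂_i, ∂_j)` of the metric in the preferred chart at `y`, at the point of
`N` with coordinates `u`. -/
def metricMatrix (g : SmoothMetric m N) (y : N) (u : Euc m) : Matrix (Fin m) (Fin m) ℝ :=
  Matrix.of fun i j =>
    g.inner ((extChartAt (𝓡 m) y).symm u) (coordVec y u i) (coordVec y u j)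

/-- The partial derivative `∂_k g_{ij}` in the preferred chart at `y`. -/
def metricDeriv (g : SmoothMetric m N) (y : N) (u : Euc m) (k i j : Fin m) : ℝ :=
  fderiv ℝ (fun w : Euc m => metricMatrix g y w i j) u (stdVec k)

/-- The Christoffel symbols of the Levi-Civita connection in the preferred chart at `y`:
`Γ^k_{ij} = ½ ∑_l g^{kl} (∂_i g_{jl} + ∂_j g_{il} - ∂_l g_{ij})`. -/
def christoffel (g : SmoothMetric m N) (y : N) (u : Euc m) (k i j : Fin m) : ℝ :=
  (1 / 2) * ∑ l, (metricMatrix g y u)⁻¹ k l *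
    (metricDeriv g y u i j l + metricDeriv g y u j i l - metricDeriv g y u l i j)

/-- The Riemannian gradient of `V : N → ℝ`, with components `(∇V)^k = ∑_l g^{kl} ∂_l V`. Here, as
everywhere below, an element of the tangent space at `y` is given by its components in the
preferred chart at `y`; this is how `TangentSpace` is defined. -/
def riemGradient (g : SmoothMetric m N) (V : N → ℝ) (y : N) : TangentSpace (𝓡 m) y :=
  WithLp.toLp 2 fun k : Fin m =>
    ∑ l, (metricMatrix g y (extChartAt (𝓡 m) y y))⁻¹ k l *
      fderiv ℝ (V ∘ (extChartAt (𝓡 m) y).symm) (extChartAt (𝓡 m) y y) (stdVec l)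

end Target

section Maps

variable {n m : ℕ} {N : Type*} [TopologicalSpace N] [ChartedSpace (Euc m) N]
  [IsManifold (𝓡 m) ∞ N]

/-- `|dφ|² = ∑_i g(dφ(e_i), dφ(e_i))` for the standard orthonormal basis `e_i` of `ℝⁿ`. -/
def normSqDiff (g : SmoothMetric m N) (φ : Euc n → N) (x : Euc n) : ℝ :=
  ∑ i : Fin n, g.inner (φ x) (mfderiv (𝓡 n) (𝓡 m) φ x (stdVec i))
    (mfderiv (𝓡 n) (𝓡 m) φ x (stdVec i))

/-- The expression of `φ : ℝⁿ → N` in the preferred chart at `φ x`. -/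
def localRep (φ : Euc n → N) (x : Euc n) : Euc n → Euc m :=
  fun z => extChartAt (𝓡 m) (φ x) (φ z)

/-- The tension field `τ(φ) = tr ∇dφ = ∑_i (∇dφ)(e_i, e_i)` of a map `φ : ℝⁿ → N`. Its value at `x`
is the tangent vector at `φ x` whose components in the preferred chart at `φ x` are
`τ^k = Δφ^k + ∑_i ∑_{a,b} Γ^k_{ab}(φ) ∂_i φ^a ∂_i φ^b`. -/
def tensionField (g : SmoothMetric m N) (φ : Euc n → N) (x : Euc n) :
    TangentSpace (𝓡 m) (φ x) :=
  WithLp.toLp 2 fun k : Fin m =>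
    Laplacian.laplacian (fun z => localRep φ x z k) x +
      ∑ i : Fin n, ∑ a : Fin m, ∑ b : Fin m,
        christoffel g (φ x) (extChartAt (𝓡 m) (φ x) (φ x)) k a b *
          fderiv ℝ (fun z => localRep φ x z a) x (stdVec i) *
          fderiv ℝ (fun z => localRep φ x z b) x (stdVec i)

/-- Smooth harmonic maps with potential `V` from `ℝⁿ` to `(N, g)`: smooth maps `φ` with
`τ(φ) = -∇V(φ)`. -/
structure IsHarmonicWithPotential (g : SmoothMetric m N) (V : N → ℝ) (φ : Euc n → N) : Prop where
  smooth : ContMDiff (𝓡 n) (𝓡 m) ∞ φ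
  equation : ∀ x, tensionField g φ x = -riemGradient g V (φ x)

/-- The energy density `½|dφ|² - V(φ)`. -/
def energyDensity (g : SmoothMetric m N) (V : N → ℝ) (φ : Euc n → N) (x : Euc n) : ℝ :=
  (1 / 2) * normSqDiff g φ x - V (φ x)

/-- The scaled energy `r^{-(n-2)} ∫_{B_r(x)} (½|dφ|² - V(φ))`. -/
def scaledEnergy (g : SmoothMetric m N) (V : N → ℝ) (φ : Euc n → N) (x : Euc n) (r : ℝ) : ℝ :=
  1 / r ^ ((n : ℤ) - 2) * ∫ y in Metric.ball x r, energyDensity g V φ y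

end Maps

end HarmonicMap

end

/-!
The equation `τ(φ) = -∇V(φ)` says that the stress-energy tensor `e • δ - φ^*g`, where
`e = ½|dφ|² - V(φ)`, is divergence free. Hence the vector field `W` dual to `(φ^*g)(y - x, ·)` has
divergence `de(y - x) + |dφ|²`. Since `φ^*g ≥ 0`, `W` points outwards, so its divergence has
nonnegative integral over `B_r(x)`; this is obtained by integrating against smooth radial cutoffs,
which avoids boundary integrals. Rescaling the ball to a fixed one shows that the derivative of
`r^{2-n} ∫_{B_r(x)} e` is `r^{1-n} ∫_{B_r(x)} (2e + de(y - x))`, and `2e = |dφ|² - 2V(φ) ≥ |dφ|²`.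
-/

namespace HarmonicMap

open MeasureTheory Metric Filter Topology Module
open scoped Pointwise

section Dilation

variable {E F : Type*} [NormedAddCommGroup E] [NormedSpace ℝ E] [FiniteDimensional ℝ E]
  [MeasurableSpace E] [BorelSpace E] [NormedAddCommGroup F]
  (μ : Measure E)

theorem integrableOn_ball_of_continuous [IsFiniteMeasureOnCompacts μ] {f : E → F}
    (hf : Continuous f) (x : E) (r : ℝ) : IntegrableOn f (ball x r) μ :=
  (hf.continuousOn.integrableOn_compact (isCompact_closedBall x r)).mono_set ball_subset_closedBall

variable [NormedSpace ℝ F] [μ.IsAddHaarMeasure]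

theorem setIntegral_unitBall_comp_dilation (f : E → F) (x : E) {r : ℝ} (hr : 0 < r) :
    ∫ z in ball (0 : E) 1, f (x + r • z) ∂μ = (r ^ finrank ℝ E)⁻¹ • ∫ y in ball x r, f y ∂μ := by
  have hball : (fun y => x + y) ⁻¹' ball x r = r • ball (0 : E) 1 := by
    rw [smul_unitBall_of_pos hr, preimage_add_ball, sub_self]
  rw [Measure.setIntegral_comp_smul_of_pos μ (fun y => f (x + y)) _ hr, ← hball,
    (measurePreserving_add_left μ x).setIntegral_preimage_emb (measurableEmbedding_addLeft x)]

theorem hasDerivAt_setIntegral_unitBall_comp_dilation {f : E → F} (hf : ContDiff ℝ 1 f) (x : E)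
    (r : ℝ) :
    HasDerivAt (fun s : ℝ => ∫ z in ball (0 : E) 1, f (x + s • z) ∂μ)
      (∫ z in ball (0 : E) 1, fderiv ℝ f (x + r • z) z ∂μ) r := by
  have hf' : Continuous fun p : ℝ × E => fderiv ℝ f (x + p.1 • p.2) p.2 :=
    ((hf.continuous_fderiv one_ne_zero).comp (by fun_prop)).clm_apply continuous_snd
  have hcont (s : ℝ) : Continuous fun z : E => f (x + s • z) := hf.continuous.comp (by fun_prop)
  obtain ⟨C, hC⟩ := ((isCompact_closedBall r 1).prod
    (isCompact_closedBall (0 : E) 1)).exists_bound_of_continuousOn hf'.continuousOn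
  have hbound : ∀ᵐ z ∂μ.restrict (ball 0 1), ∀ s ∈ ball r 1, ‖fderiv ℝ f (x + s • z) z‖ ≤ C := by
    filter_upwards [ae_restrict_mem measurableSet_ball] with z hz s hs
    exact hC (s, z) ⟨ball_subset_closedBall hs, ball_subset_closedBall hz⟩
  have hderiv (z : E) (s : ℝ) :
      HasDerivAt (fun s : ℝ => f (x + s • z)) (fderiv ℝ f (x + s • z) z) s := by
    have hline : HasDerivAt (fun s : ℝ => x + s • z) z s := by
      simpa using ((hasDerivAt_id s).smul_const z).const_add x
    exact (hf.differentiable one_ne_zero _).hasFDerivAt.comp_hasDerivAt s hline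
  exact (hasDerivAt_integral_of_dominated_loc_of_deriv_le (ball_mem_nhds r one_pos)
    (Eventually.of_forall fun s => (hcont s).aestronglyMeasurable)
    (integrableOn_ball_of_continuous μ (hcont r) 0 1)
    (hf'.comp (by fun_prop : Continuous fun z : E => (r, z))).aestronglyMeasurable hbound
    (integrableOn_ball_of_continuous μ continuous_const 0 1)
    (Eventually.of_forall fun z s _ => hderiv z s)).2

theorem hasDerivAt_zpow_smul_setIntegral_ball {f : E → F} (hf : ContDiff ℝ 1 f) (k : ℤ) (x : E)
    {r : ℝ} (hr : 0 < r) :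
    HasDerivAt (fun s : ℝ => s ^ (k - finrank ℝ E) • ∫ y in ball x s, f y ∂μ)
      (r ^ (k - 1 - finrank ℝ E) • ∫ y in ball x r, ((k : ℝ) • f y + fderiv ℝ f y (y - x)) ∂μ)
      r := by
  have hf' : Continuous fun y => fderiv ℝ f y (y - x) :=
    (hf.continuous_fderiv one_ne_zero).clm_apply (by fun_prop)
  have hrescale (l : ℤ) (h : E → F) {s : ℝ} (hs : 0 < s) :
      s ^ (l - finrank ℝ E) • ∫ y in ball x s, h y ∂μ
        = s ^ l • ∫ z in ball (0 : E) 1, h (x + s • z) ∂μ := by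
    rw [setIntegral_unitBall_comp_dilation μ h x hs, smul_smul, zpow_sub₀ hs.ne', zpow_natCast,
      div_eq_mul_inv]
  have hderiv := (hasDerivAt_zpow k r (.inl hr.ne')).smul
    (hasDerivAt_setIntegral_unitBall_comp_dilation μ hf x r)
  have hsplit : ∫ z in ball (0 : E) 1,
        ((k : ℝ) • f (x + r • z) + fderiv ℝ f (x + r • z) (x + r • z - x)) ∂μ
      = (k : ℝ) • (∫ z in ball (0 : E) 1, f (x + r • z) ∂μ)
        + r • ∫ z in ball (0 : E) 1, fderiv ℝ f (x + r • z) z ∂μ := by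
    have hline : Continuous fun z : E => x + r • z := by fun_prop
    have hint : IntegrableOn (fun z => (k : ℝ) • f (x + r • z)) (ball 0 1) μ :=
      integrableOn_ball_of_continuous μ ((hf.continuous.comp hline).const_smul (k : ℝ)) 0 1
    have hint' : IntegrableOn (fun z => fderiv ℝ f (x + r • z) (x + r • z - x)) (ball 0 1) μ :=
      integrableOn_ball_of_continuous μ (hf'.comp hline) 0 1
    rw [integral_add hint hint']
    simp only [add_sub_cancel_left, map_smul, integral_smul]
  rw [hrescale (k - 1) _ hr, hsplit]
  refine (hderiv.congr_deriv ?_).congr_of_eventuallyEq ?_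
  · rw [smul_add, smul_smul, smul_smul, zpow_sub_one₀ hr.ne', inv_mul_cancel_right₀ hr.ne',
      mul_comm (k : ℝ), add_comm]
  · filter_upwards [lt_mem_nhds hr] with s hs using hrescale k f hs

end Dilation

section Divergence

variable {E : Type*} [NormedAddCommGroup E] [NormedSpace ℝ E]

/-- The divergence of a vector field `W` on a finite-dimensional normed space, encoded without
coordinates as the trace of the derivative of `W`. -/
noncomputable def divergence (W : E → E) (y : E) : ℝ :=
  LinearMap.trace ℝ E (fderiv ℝ W y)

theorem divergence_eq_sum_coord [FiniteDimensional ℝ E] {ι : Type*} [Fintype ι]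
    (b : Basis ι ℝ E) {W : E → E} {y : E} (hW : DifferentiableAt ℝ W y) :
    divergence W y = ∑ i, fderiv ℝ (fun z => b.coord i (W z)) y (b i) := by
  classical
  rw [divergence, LinearMap.trace_eq_matrix_trace ℝ b, Matrix.trace]
  refine Finset.sum_congr rfl fun i _ => ?_
  have hcoord : HasFDerivAt (fun z => b.coord i (W z)) _ y :=
    (b.coord i).toContinuousLinearMap.hasFDerivAt.comp y hW.hasFDerivAt
  rw [hcoord.fderiv]
  simp [LinearMap.toMatrix_apply]

theorem continuous_divergence [FiniteDimensional ℝ E] {W : E → E} (hW : ContDiff ℝ 1 W) :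
    Continuous (divergence W) :=
  have htrace : Continuous ((LinearMap.trace ℝ E).comp (ContinuousLinearMap.coeLM ℝ)) :=
    LinearMap.continuous_of_finiteDimensional _
  htrace.comp (hW.continuous_fderiv one_ne_zero)

variable [FiniteDimensional ℝ E] [MeasurableSpace E] [BorelSpace E]

theorem integral_mul_divergence (μ : Measure E) [μ.IsAddHaarMeasure] {η : E → ℝ}
    (hη : ContDiff ℝ 1 η) (hsupp : HasCompactSupport η) {W : E → E} (hW : ContDiff ℝ 1 W) :
    ∫ y, η y * divergence W y ∂μ = -∫ y, fderiv ℝ η y (W y) ∂μ := by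
  let b := finBasis ℝ E
  have hWi (i) : ContDiff ℝ 1 fun y => b.coord i (W y) :=
    (b.coord i).toContinuousLinearMap.contDiff.comp hW
  have hη' (i) : Continuous fun y => fderiv ℝ η y (b i) :=
    (hη.continuous_fderiv one_ne_zero).clm_apply continuous_const
  have hWi' (i) : Continuous fun y => fderiv ℝ (fun z => b.coord i (W z)) y (b i) :=
    ((hWi i).continuous_fderiv one_ne_zero).clm_apply continuous_const
  have hint' (i) : Integrable (fun y => η y * fderiv ℝ (fun z => b.coord i (W z)) y (b i)) μ :=
    (hη.continuous.mul (hWi' i)).integrable_of_hasCompactSupport hsupp.mul_right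
  have hint (i) : Integrable (fun y => fderiv ℝ η y (b i) * b.coord i (W y)) μ :=
    ((hη' i).mul (hWi i).continuous).integrable_of_hasCompactSupport
      (hsupp.fderiv_apply ℝ _).mul_right
  have hparts (i) : ∫ y, η y * fderiv ℝ (fun z => b.coord i (W z)) y (b i) ∂μ
      = -∫ y, fderiv ℝ η y (b i) * b.coord i (W y) ∂μ :=
    integral_mul_fderiv_eq_neg_fderiv_mul_of_integrable (hint i) (hint' i)
      ((hη.continuous.mul (hWi i).continuous).integrable_of_hasCompactSupport hsupp.mul_right)
      (fun y _ => hη.differentiable one_ne_zero y) (fun y _ => (hWi i).differentiable one_ne_zero y)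
  have hexpand (y : E) : fderiv ℝ η y (W y) = ∑ i, fderiv ℝ η y (b i) * b.coord i (W y) := by
    conv_lhs => rw [← b.sum_repr (W y), map_sum]
    simp only [map_smul, smul_eq_mul, mul_comm, Basis.coord_apply]
  simp only [divergence_eq_sum_coord b (hW.differentiable one_ne_zero _), Finset.mul_sum, hexpand]
  rw [integral_finsetSum _ fun i _ => hint' i, integral_finsetSum _ fun i _ => hint i,
    ← Finset.sum_neg_distrib]
  exact Finset.sum_congr rfl fun i _ => hparts i

end Divergence

section Radial

variable {E : Type*} [NormedAddCommGroup E] [InnerProductSpace ℝ E] [FiniteDimensional ℝ E]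
  [MeasurableSpace E] [BorelSpace E] (μ : Measure E) [μ.IsAddHaarMeasure]
  {W : E → E} {x : E}

theorem integral_radial_mul_divergence_nonneg {χ : ℝ → ℝ} (hχ : ContDiff ℝ 1 χ)
    (hanti : Antitone χ) (hsupp : HasCompactSupport fun y => χ (‖y - x‖ ^ 2))
    (hW : ContDiff ℝ 1 W) (hout : ∀ y, 0 ≤ inner ℝ (W y) (y - x)) :
    0 ≤ ∫ y, χ (‖y - x‖ ^ 2) * divergence W y ∂μ := by
  have hη : ContDiff ℝ 1 fun y => χ (‖y - x‖ ^ 2) :=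
    hχ.comp ((contDiff_id.sub contDiff_const).norm_sq ℝ)
  have hη' (y v : E) : fderiv ℝ (fun z => χ (‖z - x‖ ^ 2)) y v
      = deriv χ (‖y - x‖ ^ 2) * (2 * inner ℝ (y - x) v) := by
    have h : HasFDerivAt (fun z => χ (‖z - x‖ ^ 2)) _ y :=
      (hχ.differentiable one_ne_zero _).hasDerivAt.comp_hasFDerivAt y
        ((hasFDerivAt_id y).sub_const x).norm_sq
    simp [h.fderiv, inner_sub_left]
  rw [integral_mul_divergence μ hη hsupp hW, ← integral_neg]
  refine integral_nonneg fun y => ?_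
  rw [Pi.zero_apply, hη', real_inner_comm, ← neg_mul]
  exact mul_nonneg (neg_nonneg.2 hanti.deriv_nonpos) (mul_nonneg zero_le_two (hout y))

/-- A smooth antitone function of `t = ‖y - x‖ ^ 2` vanishing for `t ≥ r ^ 2`. As `k → ∞` these
increase to the indicator function of `t < r ^ 2`, that is, of the ball of radius `r` around `x`. -/
noncomputable def ballCutoff (r : ℝ) (k : ℕ) (t : ℝ) : ℝ :=
  Real.smoothTransition (k * (r ^ 2 - t))

theorem contDiff_ballCutoff (r : ℝ) (k : ℕ) {n : ℕ∞} : ContDiff ℝ n (ballCutoff r k) :=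
  Real.smoothTransition.contDiff.comp (by fun_prop)

theorem antitone_ballCutoff (r : ℝ) (k : ℕ) : Antitone (ballCutoff r k) := fun s t hst =>
  Real.smoothTransition.monotone (by gcongr)

theorem ballCutoff_eq_zero {r t : ℝ} (k : ℕ) (ht : r ^ 2 ≤ t) : ballCutoff r k t = 0 :=
  Real.smoothTransition.zero_of_nonpos
    (mul_nonpos_of_nonneg_of_nonpos k.cast_nonneg (sub_nonpos.2 ht))

theorem norm_ballCutoff_le_one (r : ℝ) (k : ℕ) (t : ℝ) : ‖ballCutoff r k t‖ ≤ 1 := by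
  rw [ballCutoff, Real.norm_of_nonneg (Real.smoothTransition.nonneg _)]
  exact Real.smoothTransition.le_one _

theorem tendsto_ballCutoff {r t : ℝ} (ht : t < r ^ 2) :
    Tendsto (fun k => ballCutoff r k t) atTop (𝓝 1) := by
  refine tendsto_const_nhds.congr' ?_
  filter_upwards [(tendsto_natCast_atTop_atTop.atTop_mul_const
    (sub_pos.2 ht)).eventually_ge_atTop 1] with k hk
  exact (Real.smoothTransition.one_of_one_le hk).symm

theorem setIntegral_ball_divergence_nonneg (hW : ContDiff ℝ 1 W)
    (hout : ∀ y, 0 ≤ inner ℝ (W y) (y - x)) {r : ℝ} (hr : 0 ≤ r) :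
    0 ≤ ∫ y in ball x r, divergence W y ∂μ := by
  have hdiv := continuous_divergence hW
  have hmem (y : E) : y ∈ ball x r ↔ ‖y - x‖ ^ 2 < r ^ 2 := by
    rw [mem_ball_iff_norm, sq_lt_sq₀ (norm_nonneg _) hr]
  have hzero {y : E} (hy : y ∉ ball x r) (k : ℕ) : ballCutoff r k (‖y - x‖ ^ 2) = 0 :=
    ballCutoff_eq_zero k (not_lt.1 (mt (hmem y).2 hy))
  have hsupp (k : ℕ) : HasCompactSupport fun y => ballCutoff r k (‖y - x‖ ^ 2) :=
    .intro (isCompact_closedBall x r) fun y hy => hzero (fun h => hy (ball_subset_closedBall h)) k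
  have hcont (k : ℕ) : Continuous fun y => ballCutoff r k (‖y - x‖ ^ 2) * divergence W y :=
    ((contDiff_ballCutoff (n := 0) r k).continuous.comp (by fun_prop)).mul hdiv
  have hbound (k : ℕ) (y : E) : ‖ballCutoff r k (‖y - x‖ ^ 2) * divergence W y‖
      ≤ (ball x r).indicator (fun y => ‖divergence W y‖) y := by
    by_cases hy : y ∈ ball x r
    · rw [Set.indicator_of_mem hy, norm_mul]
      exact mul_le_of_le_one_left (norm_nonneg _) (norm_ballCutoff_le_one _ _ _)
    · rw [Set.indicator_of_notMem hy, hzero hy, zero_mul, norm_zero]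
  have hlim (y : E) : Tendsto (fun k => ballCutoff r k (‖y - x‖ ^ 2) * divergence W y) atTop
      (𝓝 ((ball x r).indicator (divergence W) y)) := by
    by_cases hy : y ∈ ball x r
    · simpa [Set.indicator_of_mem hy] using (tendsto_ballCutoff ((hmem y).1 hy)).mul_const _
    · simp [Set.indicator_of_notMem hy, hzero hy]
  rw [← integral_indicator measurableSet_ball]
  exact ge_of_tendsto' (tendsto_integral_of_dominated_convergence _
    (fun k => (hcont k).aestronglyMeasurable)
    ((integrableOn_ball_of_continuous μ hdiv.norm x r).integrable_indicator measurableSet_ball)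
    (fun k => .of_forall (hbound k)) (.of_forall hlim))
    fun k => integral_radial_mul_divergence_nonneg μ (contDiff_ballCutoff (n := 1) r k)
      (antitone_ballCutoff r k) (hsupp k) hW hout

end Radial

section Conservation

theorem contDiff_flip {E F : Type*} [NormedAddCommGroup E] [NormedSpace ℝ E]
    [NormedAddCommGroup F] [NormedSpace ℝ F] {k : WithTop ℕ∞} :
    ContDiff ℝ k (ContinuousLinearMap.flip : (E →L[ℝ] F →L[ℝ] ℝ) → F →L[ℝ] E →L[ℝ] ℝ) :=
  LinearIsometryEquiv.contDiff (𝕜 := ℝ) (E := E →L[ℝ] F →L[ℝ] ℝ) (F := F →L[ℝ] E →L[ℝ] ℝ)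
    (ContinuousLinearMap.flipₗᵢ ℝ E F ℝ)

variable {E ι : Type*} [NormedAddCommGroup E] [InnerProductSpace ℝ E] [FiniteDimensional ℝ E]
  [Fintype ι] (b : OrthonormalBasis ι ℝ E) {B : E → E →L[ℝ] E →L[ℝ] ℝ} {x : E}

/-- The contraction of a field of bilinear forms `B` with the radial vector field `y ↦ y - x`: the
vector field `W` with `⟪W y, v⟫ = B y v (y - x)`. -/
noncomputable def radialContraction (B : E → E →L[ℝ] E →L[ℝ] ℝ) (x y : E) : E :=
  (InnerProductSpace.toDual ℝ E).symm ((B y).flip (y - x))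

theorem inner_radialContraction (y v : E) :
    inner ℝ (radialContraction B x y) v = B y v (y - x) :=
  InnerProductSpace.toDual_symm_apply

theorem contDiff_radialContraction (hB : ContDiff ℝ 1 B) :
    ContDiff ℝ 1 (radialContraction B x) :=
  (InnerProductSpace.toDual ℝ E).symm.contDiff.comp
    ((contDiff_flip.comp hB).clm_apply (contDiff_id.sub contDiff_const))

theorem divergence_radialContraction (hB : ContDiff ℝ 1 B) (y : E) :
    divergence (radialContraction B x) y
      = ∑ i, fderiv ℝ B y (b i) (b i) (y - x) + ∑ i, B y (b i) (b i) := by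
  have hcoord (i : ι) (z : E) :
      b.toBasis.coord i (radialContraction B x z) = B z (b i) (z - x) := by
    rw [Basis.coord_apply, OrthonormalBasis.coe_toBasis_repr_apply,
      OrthonormalBasis.repr_apply_apply, real_inner_comm, inner_radialContraction]
  have hderiv (i : ι) : HasFDerivAt (fun z => B z (b i) (z - x)) _ y :=
    ((hB.differentiable one_ne_zero y).hasFDerivAt.clm_apply
      (hasFDerivAt_const (b i) y)).clm_apply ((hasFDerivAt_id y).sub_const x)
  rw [divergence_eq_sum_coord b.toBasis
    ((contDiff_radialContraction hB).differentiable one_ne_zero y), ← Finset.sum_add_distrib]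
  refine Finset.sum_congr rfl fun i _ => ?_
  simp only [hcoord]
  rw [(hderiv i).fderiv]
  simp [add_comm]

variable [MeasurableSpace E] [BorelSpace E] (μ : Measure E) [μ.IsAddHaarMeasure]

theorem deriv_zpow_smul_setIntegral_ball_nonneg (hB : ContDiff ℝ 1 B)
    (hpos : ∀ y v, 0 ≤ B y v v) {f : E → ℝ} (hf : ContDiff ℝ 1 f)
    (hdiv : ∀ y v, ∑ i, fderiv ℝ B y (b i) (b i) v = fderiv ℝ f y v) {k : ℤ}
    (htrace : ∀ y, ∑ i, B y (b i) (b i) ≤ k * f y) {r : ℝ} (hr : 0 < r) :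
    0 ≤ deriv (fun s : ℝ => s ^ (k - finrank ℝ E) • ∫ y in ball x s, f y ∂μ) r := by
  have hW := contDiff_radialContraction (x := x) hB
  have hcont : Continuous fun y => (k : ℝ) • f y + fderiv ℝ f y (y - x) :=
    (hf.continuous.const_smul (k : ℝ)).add
      ((hf.continuous_fderiv one_ne_zero).clm_apply (continuous_sub_right x))
  have hle (y : E) : divergence (radialContraction B x) y
      ≤ (k : ℝ) • f y + fderiv ℝ f y (y - x) := by
    rw [divergence_radialContraction b hB, hdiv, add_comm, smul_eq_mul]
    gcongr
    exact htrace y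
  rw [(hasDerivAt_zpow_smul_setIntegral_ball μ hf k x hr).deriv]
  refine smul_nonneg (zpow_nonneg hr.le _) ?_
  calc
    0 ≤ ∫ y in ball x r, divergence (radialContraction B x) y ∂μ :=
      setIntegral_ball_divergence_nonneg μ hW
        (fun y => (inner_radialContraction y _).symm ▸ hpos y _) hr.le
    _ ≤ ∫ y in ball x r, ((k : ℝ) • f y + fderiv ℝ f y (y - x)) ∂μ :=
      setIntegral_mono (integrableOn_ball_of_continuous μ (continuous_divergence hW) x r)
        (integrableOn_ball_of_continuous μ hcont x r) hle

end Conservation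

section PullbackForm

variable {E F : Type*} [NormedAddCommGroup E] [NormedSpace ℝ E]
  [NormedAddCommGroup F] [NormedSpace ℝ F] {G : F → F →L[ℝ] F →L[ℝ] ℝ} {u : E → F} {x : E}

/-- The pullback `u^*G` of a field of bilinear forms `G` by a map `u`. -/
noncomputable def pullbackForm (G : F → F →L[ℝ] F →L[ℝ] ℝ) (u : E → F) (z : E) :
    E →L[ℝ] E →L[ℝ] ℝ :=
  (G (u z)).bilinearComp (fderiv ℝ u z) (fderiv ℝ u z)

/-- The Christoffel symbols of the first kind of a field of bilinear forms `G` at the point `p`: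
`Γ(v, w) = ½ (∂_v G(w, ·) + ∂_w G(v, ·) - ∂_· G(v, w))`. -/
noncomputable def christoffelFirst (G : F → F →L[ℝ] F →L[ℝ] ℝ) (p v w : F) : F →L[ℝ] ℝ :=
  (1 / 2 : ℝ) • (fderiv ℝ G p v w + fderiv ℝ G p w v - ((fderiv ℝ G p).flip v).flip w)

theorem christoffelFirst_apply (p v w l : F) : christoffelFirst G p v w l
    = 1 / 2 * (fderiv ℝ G p v w l + fderiv ℝ G p w v l - fderiv ℝ G p l v w) :=
  rfl

theorem fderiv_apply_apply_eq {B : E → E →L[ℝ] E →L[ℝ] ℝ} (hB : DifferentiableAt ℝ B x)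
    (k v w : E) : fderiv ℝ (fun z => B z v w) x k = fderiv ℝ B x k v w := by
  have h : HasFDerivAt (fun z => B z v w) _ x :=
    (hB.hasFDerivAt.clm_apply (hasFDerivAt_const v x)).clm_apply (hasFDerivAt_const w x)
  rw [h.fderiv]
  simp

theorem contDiffAt_pullbackForm {k : WithTop ℕ∞} (hG : ContDiffAt ℝ k G (u x))
    (hu : ContDiffAt ℝ (k + 1) u x) : ContDiffAt ℝ k (pullbackForm G u) x := by
  have hdu : ContDiffAt ℝ k (fderiv ℝ u) x := hu.fderiv_right le_rfl
  have hGdu : ContDiffAt ℝ k (fun z => (G (u z)).comp (fderiv ℝ u z)) x :=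
    (hG.comp x (hu.of_le le_self_add)).clm_comp hdu
  exact contDiff_flip.contDiffAt.comp x ((contDiff_flip.contDiffAt.comp x hGdu).clm_comp hdu)

theorem fderiv_pullbackForm (hG : ContDiffAt ℝ 1 G (u x)) (hu : ContDiffAt ℝ 2 u x)
    (k v w : E) :
    fderiv ℝ (pullbackForm G u) x k v w
      = fderiv ℝ G (u x) (fderiv ℝ u x k) (fderiv ℝ u x v) (fderiv ℝ u x w)
        + G (u x) (fderiv ℝ (fderiv ℝ u) x k v) (fderiv ℝ u x w)
        + G (u x) (fderiv ℝ u x v) (fderiv ℝ (fderiv ℝ u) x k w) := by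
  have hdu (v : E) : HasFDerivAt (fun z => fderiv ℝ u z v) _ x :=
    ((hu.fderiv_right (m := 1) le_rfl).differentiableAt one_ne_zero).hasFDerivAt.clm_apply
      (hasFDerivAt_const v x)
  have hGu : HasFDerivAt (fun z => G (u z)) ((fderiv ℝ G (u x)).comp (fderiv ℝ u x)) x :=
    HasFDerivAt.comp (G := F →L[ℝ] F →L[ℝ] ℝ) x
      (hG.differentiableAt one_ne_zero).hasFDerivAt (hu.differentiableAt two_ne_zero).hasFDerivAt
  have h : HasFDerivAt (fun z => pullbackForm G u z v w) _ x :=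
    (hGu.clm_apply (hdu v)).clm_apply (hdu w)
  rw [← fderiv_apply_apply_eq
    ((contDiffAt_pullbackForm hG hu).differentiableAt one_ne_zero), h.fderiv]
  simp
  ring

end PullbackForm

section Laplacian

variable {E F ι : Type*} [NormedAddCommGroup E] [InnerProductSpace ℝ E] [FiniteDimensional ℝ E]
  [NormedAddCommGroup F] [NormedSpace ℝ F] [Fintype ι] (b : OrthonormalBasis ι ℝ E)
  {G : F → F →L[ℝ] F →L[ℝ] ℝ} {u : E → F} {x : E}

theorem sum_fderiv_pullbackForm (hG : ContDiffAt ℝ 1 G (u x))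
    (hsymm : ∀ v w, G (u x) v w = G (u x) w v) (hu : ContDiffAt ℝ 2 u x) (v : E) :
    ∑ i, fderiv ℝ (pullbackForm G u) x (b i) (b i) v
      = 1 / 2 * ∑ i, fderiv ℝ (pullbackForm G u) x v (b i) (b i)
        + (G (u x) (Laplacian.laplacian u x)
          + ∑ i, christoffelFirst G (u x) (fderiv ℝ u x (b i)) (fderiv ℝ u x (b i)))
            (fderiv ℝ u x v) := by
  have hcomm (i : ι) : fderiv ℝ (fderiv ℝ u) x v (b i) = fderiv ℝ (fderiv ℝ u) x (b i) v :=
    hu.isSymmSndFDerivAt (by simp) v (b i)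
  have hlaplacian : Laplacian.laplacian u x = ∑ i, fderiv ℝ (fderiv ℝ u) x (b i) (b i) := by
    simp [InnerProductSpace.laplacian_eq_iteratedFDeriv_orthonormalBasis u b,
      iteratedFDeriv_two_apply]
  rw [hlaplacian, map_sum, ← Finset.sum_add_distrib, sum_apply,
    Finset.mul_sum, ← Finset.sum_add_distrib]
  refine Finset.sum_congr rfl fun i _ => ?_
  rw [add_apply, christoffelFirst_apply, fderiv_pullbackForm hG hu,
    fderiv_pullbackForm hG hu, hcomm, hsymm (fderiv ℝ u x (b i))]
  ring

end Laplacian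

section PullbackMetric

variable {E F : Type*} [NormedAddCommGroup E] [NormedSpace ℝ E] [NormedAddCommGroup F]
  [NormedSpace ℝ F] {m : ℕ} {N : Type*} [TopologicalSpace N] [ChartedSpace (Euc m) N]
  [IsManifold (𝓡 m) ∞ N] (g : SmoothMetric m N)

/-- The pullback `f^*g` of a Riemannian metric by a map `f` defined on a vector space. -/
noncomputable def pullbackMetric (f : E → N) (z : E) : E →L[ℝ] E →L[ℝ] ℝ :=
  ContinuousLinearMap.bilinearComp (E := Euc m) (F := Euc m) (E' := E) (F' := E)
    (g.inner (f z)) (mfderiv 𝓘(ℝ, E) (𝓡 m) f z) (mfderiv 𝓘(ℝ, E) (𝓡 m) f z)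

theorem pullbackMetric_symm (f : E → N) (z v w : E) :
    pullbackMetric g f z v w = pullbackMetric g f z w v :=
  g.symm _ _ _

theorem pullbackMetric_self_pos {f : E → N} {z v : E} (hv : mfderiv 𝓘(ℝ, E) (𝓡 m) f z v ≠ 0) :
    0 < pullbackMetric g f z v v :=
  g.pos _ _ hv

theorem pullbackMetric_self_nonneg (f : E → N) (z v : E) : 0 ≤ pullbackMetric g f z v v := by
  by_cases hv : mfderiv 𝓘(ℝ, E) (𝓡 m) f z v = 0
  · exact (congrArg (fun w => g.inner (f z) w w) hv).trans (map_zero _) |>.ge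
  · exact (pullbackMetric_self_pos g hv).le

theorem pullbackMetric_congr {f f' : E → N} {z : E} (h : f =ᶠ[𝓝 z] f') :
    pullbackMetric g f z = pullbackMetric g f' z := by
  have hinner {p q : N} (hpq : p = q) (v w : Euc m) : g.inner p v w = g.inner q v w := by
    subst hpq; rfl
  ext v w
  refine (hinner h.eq_of_nhds _ _).trans ?_
  rw [h.mfderiv_eq]
  rfl

theorem pullbackMetric_comp {f : F → N} {u : E → F} {z : E}
    (hf : MDifferentiableAt 𝓘(ℝ, F) (𝓡 m) f (u z)) (hu : DifferentiableAt ℝ u z) :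
    pullbackMetric g (f ∘ u) z = pullbackForm (pullbackMetric g f) u z := by
  ext v w
  rw [pullbackMetric, mfderiv_comp z hf hu.mdifferentiableAt, mfderiv_eq_fderiv]
  rfl

theorem contMDiffOn_mfderiv_apply {f : E → N} {s : Set E} (hs : IsOpen s) {k : WithTop ℕ∞}
    (hk : k + 1 ≤ ∞) (hf : ContMDiffOn 𝓘(ℝ, E) (𝓡 m) (k + 1) f s) (v : E) :
    ContMDiffOn 𝓘(ℝ, E) (𝓡 m).tangent k
      (fun z => Bundle.TotalSpace.mk' (Euc m) (f z) (mfderiv 𝓘(ℝ, E) (𝓡 m) f z v)) s := by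
  have := IsManifold.of_le (I := 𝓡 m) (M := N) hk
  have hconst : ContMDiff 𝓘(ℝ, E) 𝓘(ℝ, E).tangent k
      (fun z : E => (⟨z, v⟩ : TangentBundle 𝓘(ℝ, E) E)) := fun _ =>
    contMDiffAt_vectorSpace_iff_contDiffAt.2 contDiffAt_const
  refine ((hf.contMDiffOn_tangentMapWithin le_rfl hs.uniqueMDiffOn).comp
    hconst.contMDiffOn fun z hz => hz).congr fun z hz => ?_
  simp only [Function.comp_apply, tangentMapWithin, mfderivWithin_of_isOpen hs hz]

theorem contDiffOn_pullbackMetric [FiniteDimensional ℝ E] {f : E → N} {s : Set E} (hs : IsOpen s)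
    {k : WithTop ℕ∞} (hk : k + 1 ≤ ∞) (hf : ContMDiffOn 𝓘(ℝ, E) (𝓡 m) (k + 1) f s) :
    ContDiffOn ℝ k (pullbackMetric g f) s := by
  refine contDiffOn_clm_apply.2 fun v => contDiffOn_clm_apply.2 fun w z hz => ?_
  have h : ContMDiffWithinAt 𝓘(ℝ, E) ((𝓡 m).prod 𝓘(ℝ)) k
      (fun z => Bundle.TotalSpace.mk' ℝ (E := Bundle.Trivial N ℝ) (f z)
        (g.inner (f z) (mfderiv 𝓘(ℝ, E) (𝓡 m) f z v) (mfderiv 𝓘(ℝ, E) (𝓡 m) f z w))) s z := by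
    apply ContMDiffWithinAt.clm_bundle_apply₂ (F₁ := Euc m) (F₂ := Euc m)
    · exact (g.contMDiff.of_le (le_self_add.trans hk)).contMDiffAt.comp_contMDiffWithinAt z
        ((hf.of_le le_self_add) z hz)
    · exact contMDiffOn_mfderiv_apply hs hk hf v z hz
    · exact contMDiffOn_mfderiv_apply hs hk hf w z hz
  exact (Bundle.contMDiffWithinAt_totalSpace.1 h).2.contDiffWithinAt

end PullbackMetric

section ChartMetric

variable {m : ℕ} {N : Type*} [TopologicalSpace N] [ChartedSpace (Euc m) N]
  [IsManifold (𝓡 m) ∞ N] (g : SmoothMetric m N) {y : N} {u : Euc m}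

theorem sum_smul_stdVec (v : Euc m) : ∑ a, v a • (stdVec a : Euc m) = v := by
  simpa using (EuclideanSpace.basisFun (Fin m) ℝ).sum_repr v

/-- The metric in the preferred chart at `y`, as a field of bilinear forms on the model space. Its
matrix in the standard basis is `metricMatrix g y`. -/
noncomputable def chartMetric (y : N) : Euc m → Euc m →L[ℝ] Euc m →L[ℝ] ℝ :=
  pullbackMetric g (extChartAt (𝓡 m) y).symm

theorem chartMetric_stdVec (i j : Fin m) :
    chartMetric g y u (stdVec i) (stdVec j) = metricMatrix g y u i j :=
  rfl

theorem chartMetric_symm (v w : Euc m) :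
    chartMetric g y u v w = chartMetric g y u w v :=
  pullbackMetric_symm g _ _ _ _

theorem contDiffAt_chartMetric (hu : u ∈ (extChartAt (𝓡 m) y).target) :
    ContDiffAt ℝ ∞ (chartMetric g y) u :=
  have hsymm : ContMDiffOn 𝓘(ℝ, Euc m) (𝓡 m) (∞ + 1) (extChartAt (𝓡 m) y).symm
      (extChartAt (𝓡 m) y).target :=
    contMDiffOn_extChartAt_symm (n := ∞) y
  (contDiffOn_pullbackMetric g (isOpen_extChartAt_target y) le_rfl hsymm).contDiffAt
    ((isOpen_extChartAt_target y).mem_nhds hu)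

theorem fderiv_chartMetric_stdVec (hu : u ∈ (extChartAt (𝓡 m) y).target) (k i j : Fin m) :
    fderiv ℝ (chartMetric g y) u (stdVec k) (stdVec i) (stdVec j) = metricDeriv g y u k i j :=
  (fderiv_apply_apply_eq
    ((contDiffAt_chartMetric g hu).differentiableAt (by simp)) _ _ _).symm

theorem chartMetric_self_pos (hu : u ∈ (extChartAt (𝓡 m) y).target) {v : Euc m} (hv : v ≠ 0) :
    0 < chartMetric g y u v v := by
  refine pullbackMetric_self_pos g fun h => hv ?_
  have hleft := mfderiv_extChartAt_comp_mfderivWithin_extChartAt_symm (I := 𝓡 m) hu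
  rw [ModelWithCorners.range_eq_univ, mfderivWithin_univ] at hleft
  exact (DFunLike.congr_fun hleft v).symm.trans
    ((congrArg (mfderiv (𝓡 m) 𝓘(ℝ, Euc m) (extChartAt (𝓡 m) y)
      ((extChartAt (𝓡 m) y).symm u)) h).trans (ContinuousLinearMap.map_zero _))

open scoped Matrix in
theorem metricMatrix_mulVec (v : Euc m) (j : Fin m) :
    (metricMatrix g y u *ᵥ v) j = chartMetric g y u v (stdVec j) := by
  have hsum : chartMetric g y u v (stdVec j)
      = ∑ a, v a * chartMetric g y u (stdVec a) (stdVec j) := by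
    conv_lhs => rw [← sum_smul_stdVec v]
    simp only [map_sum, map_smul, sum_apply, smul_apply, smul_eq_mul]
  rw [hsum, Matrix.mulVec, dotProduct]
  refine Finset.sum_congr rfl fun a _ => ?_
  rw [chartMetric_symm, chartMetric_stdVec, mul_comm]

theorem isUnit_det_metricMatrix (hu : u ∈ (extChartAt (𝓡 m) y).target) :
    IsUnit (metricMatrix g y u).det := by
  rw [isUnit_iff_ne_zero]
  intro hdet
  obtain ⟨v, hv, hker⟩ := Matrix.exists_mulVec_eq_zero_iff.2 hdet
  have hpos := chartMetric_self_pos g hu ((WithLp.toLp_eq_zero 2).not.2 hv)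
  have hzero : chartMetric g y u (WithLp.toLp 2 v) = 0 := by
    refine ContinuousLinearMap.ext fun w => ?_
    rw [← sum_smul_stdVec w, map_sum]
    refine Finset.sum_eq_zero fun j _ => ?_
    rw [map_smul, ← metricMatrix_mulVec, hker, Pi.zero_apply, smul_zero]
  exact hpos.ne' (DFunLike.congr_fun hzero _)

open scoped Matrix in
/-- The vector obtained from a linear form by raising the index with the metric in the preferred
chart at `y`: its components are `∑ l, g^{kl} α_l`. -/
noncomputable def raise (y : N) (u : Euc m) (α : Euc m →L[ℝ] ℝ) : Euc m :=
  WithLp.toLp 2 ((metricMatrix g y u)⁻¹ *ᵥ fun l => α (stdVec l))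

theorem chartMetric_raise (hu : u ∈ (extChartAt (𝓡 m) y).target) (α : Euc m →L[ℝ] ℝ) :
    chartMetric g y u (raise g y u α) = α := by
  refine ContinuousLinearMap.ext fun w => ?_
  rw [← sum_smul_stdVec w, map_sum, map_sum]
  refine Finset.sum_congr rfl fun j _ => ?_
  rw [map_smul, map_smul, ← metricMatrix_mulVec, raise, Matrix.mulVec_mulVec,
    Matrix.mul_nonsing_inv _ (isUnit_det_metricMatrix g hu), Matrix.one_mulVec]

theorem chartMetric_riemGradient (V : N → ℝ) (y : N) :
    chartMetric g y (extChartAt (𝓡 m) y y) (riemGradient g V y)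
      = fderiv ℝ (V ∘ (extChartAt (𝓡 m) y).symm) (extChartAt (𝓡 m) y y) :=
  chartMetric_raise g (mem_extChartAt_target y) _

theorem christoffelFirst_chartMetric_stdVec (hu : u ∈ (extChartAt (𝓡 m) y).target) (v w : Euc m)
    (l : Fin m) :
    christoffelFirst (chartMetric g y) u v w (stdVec l) = ∑ a, ∑ b, 1 / 2 *
      (metricDeriv g y u a b l + metricDeriv g y u b a l - metricDeriv g y u l a b) *
        v a * w b := by
  have hleft (D : Euc m →L[ℝ] Euc m →L[ℝ] Euc m →L[ℝ] ℝ) (v w : Euc m) :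
      D v w (stdVec l) = ∑ a, ∑ b, w b * (v a * D (stdVec a) (stdVec b) (stdVec l)) := by
    conv_lhs => rw [← sum_smul_stdVec v, ← sum_smul_stdVec w]
    simp only [map_sum, map_smul, sum_apply, smul_apply, smul_eq_mul, Finset.mul_sum]
    exact Finset.sum_comm
  have hright (D : Euc m →L[ℝ] Euc m →L[ℝ] Euc m →L[ℝ] ℝ) :
      D (stdVec l) v w = ∑ a, ∑ b, w b * (v a * D (stdVec l) (stdVec a) (stdVec b)) := by
    conv_lhs => rw [← sum_smul_stdVec v, ← sum_smul_stdVec w]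
    simp only [map_sum, map_smul, sum_apply, smul_apply, smul_eq_mul, Finset.mul_sum]
    exact Finset.sum_comm
  rw [christoffelFirst_apply, hleft _ v w, (hleft _ w v).trans Finset.sum_comm, hright]
  simp only [fderiv_chartMetric_stdVec g hu, ← Finset.sum_add_distrib, ← Finset.sum_sub_distrib,
    Finset.mul_sum]
  exact Finset.sum_congr rfl fun a _ => Finset.sum_congr rfl fun b _ => by ring

theorem sum_christoffel_mul_mul (hu : u ∈ (extChartAt (𝓡 m) y).target) (v w : Euc m)
    (k : Fin m) :
    ∑ a, ∑ b, christoffel g y u k a b * v a * w b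
      = raise g y u (christoffelFirst (chartMetric g y) u v w) k := by
  simp only [raise, Matrix.mulVec, dotProduct, christoffelFirst_chartMetric_stdVec g hu,
    christoffel, Finset.mul_sum, Finset.sum_mul]
  conv_rhs => rw [Finset.sum_comm]
  refine Finset.sum_congr rfl fun a _ => ?_
  conv_rhs => rw [Finset.sum_comm]
  exact Finset.sum_congr rfl fun b _ => Finset.sum_congr rfl fun l _ => by ring

end ChartMetric

section EnergyDensity

variable {n m : ℕ} {N : Type*} [TopologicalSpace N] [ChartedSpace (Euc m) N]
  {φ : Euc n → N} {x : Euc n}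

theorem eventuallyEq_symm_comp_localRep (hφ : ContinuousAt φ x) :
    φ =ᶠ[𝓝 x] (extChartAt (𝓡 m) (φ x)).symm ∘ localRep (m := m) φ x := by
  filter_upwards [hφ.eventually_mem (extChartAt_source_mem_nhds (I := 𝓡 m) (φ x))] with z hz
  exact ((extChartAt (𝓡 m) (φ x)).left_inv hz).symm

variable [IsManifold (𝓡 m) ∞ N] (g : SmoothMetric m N) {V : N → ℝ}

theorem contDiffAt_localRep {k : WithTop ℕ∞} (hk : k ≤ ∞)
    (hφ : ContMDiffAt (𝓡 n) (𝓡 m) k φ x) : ContDiffAt ℝ k (localRep (m := m) φ x) x :=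
  have := IsManifold.of_le (I := 𝓡 m) (M := N) hk
  (contMDiffAt_extChartAt.comp x hφ).contDiffAt

theorem pullbackMetric_eventuallyEq (hφ : ContMDiffAt (𝓡 n) (𝓡 m) 1 φ x) :
    pullbackMetric g φ =ᶠ[𝓝 x] pullbackForm (chartMetric g (φ x)) (localRep φ x) := by
  have hu := contDiffAt_localRep (by simp) hφ
  have htarget : ∀ᶠ z in 𝓝 x, localRep φ x z ∈ (extChartAt (𝓡 m) (φ x)).target :=
    hu.continuousAt.eventually_mem (extChartAt_target_mem_nhds (φ x))
  filter_upwards [(eventuallyEq_symm_comp_localRep (m := m) hφ.continuousAt).eventuallyEq_nhds,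
    htarget, hu.eventually (by simp)] with z hz hzt huz
  have hsymm : ContMDiffAt 𝓘(ℝ, Euc m) (𝓡 m) ∞ (extChartAt (𝓡 m) (φ x)).symm
      (localRep φ x z) :=
    (contMDiffOn_extChartAt_symm (φ x)).contMDiffAt
      ((isOpen_extChartAt_target (φ x)).mem_nhds hzt)
  rw [pullbackMetric_congr g hz, pullbackMetric_comp g (hsymm.mdifferentiableAt (by simp))
    (huz.differentiableAt one_ne_zero), chartMetric]

theorem tensionField_eq (hφ : ContMDiffAt (𝓡 n) (𝓡 m) 2 φ x) :
    tensionField g φ x = Laplacian.laplacian (localRep (m := m) φ x) x +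
      ∑ i, raise g (φ x) (localRep φ x x) (christoffelFirst (chartMetric g (φ x)) (localRep φ x x)
        (fderiv ℝ (localRep φ x) x (stdVec i)) (fderiv ℝ (localRep φ x) x (stdVec i))) := by
  have hu := contDiffAt_localRep ENat.LEInfty.out hφ
  have hlaplacian (k : Fin m) : Laplacian.laplacian (fun z => localRep φ x z k) x
      = Laplacian.laplacian (localRep (m := m) φ x) x k :=
    hu.laplacian_CLM_comp_left (l := EuclideanSpace.proj (𝕜 := ℝ) k)
  have hfderiv (a : Fin m) (v : Euc n) :
      fderiv ℝ (fun z => localRep (m := m) φ x z a) x v = fderiv ℝ (localRep φ x) x v a := by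
    have h := (EuclideanSpace.proj (𝕜 := ℝ) a : Euc m →L[ℝ] ℝ).hasFDerivAt.comp x
      (hu.differentiableAt two_ne_zero).hasFDerivAt
    exact DFunLike.congr_fun h.fderiv v
  refine PiLp.ext fun k => ?_
  rw [PiLp.add_apply, WithLp.ofLp_sum, Finset.sum_apply]
  simp only [tensionField, hlaplacian, hfderiv]
  refine congrArg₂ (· + ·) rfl (Finset.sum_congr rfl fun i _ => ?_)
  exact sum_christoffel_mul_mul g (mem_extChartAt_target (φ x)) _ _ k

theorem chartMetric_tensionField (hφ : ContMDiffAt (𝓡 n) (𝓡 m) 2 φ x) :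
    chartMetric g (φ x) (localRep φ x x) (tensionField g φ x)
      = chartMetric g (φ x) (localRep φ x x) (Laplacian.laplacian (localRep φ x) x)
        + ∑ i, christoffelFirst (chartMetric g (φ x)) (localRep φ x x)
          (fderiv ℝ (localRep φ x) x (stdVec i)) (fderiv ℝ (localRep φ x) x (stdVec i)) := by
  rw [tensionField_eq g hφ, map_add, map_sum]
  simp only [chartMetric_raise g (u := localRep φ x x) (mem_extChartAt_target (φ x))]

theorem fderiv_comp_eq_chartMetric_riemGradient (hV : MDifferentiableAt (𝓡 m) 𝓘(ℝ, ℝ) V (φ x))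
    (hφ : ContMDiffAt (𝓡 n) (𝓡 m) 1 φ x) (v : Euc n) :
    fderiv ℝ (V ∘ φ) x v
      = chartMetric g (φ x) (localRep φ x x) (riemGradient g V (φ x))
        (fderiv ℝ (localRep φ x) x v) := by
  have hu : DifferentiableAt ℝ (localRep (m := m) φ x) x :=
    (contDiffAt_localRep (by simp) hφ).differentiableAt one_ne_zero
  have hVs : DifferentiableAt ℝ (V ∘ (extChartAt (𝓡 m) (φ x)).symm) (localRep φ x x) := by
    have hsymm : MDifferentiableAt 𝓘(ℝ, Euc m) (𝓡 m) (extChartAt (𝓡 m) (φ x)).symm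
        (localRep φ x x) :=
      (mdifferentiableOn_extChartAt_symm _ (mem_extChartAt_target (φ x))).mdifferentiableAt
        (extChartAt_target_mem_nhds (φ x))
    refine (MDifferentiableAt.comp (localRep φ x x) ?_ hsymm).differentiableAt
    rwa [show (extChartAt (𝓡 m) (φ x)).symm (localRep φ x x) = φ x from extChartAt_to_inv (φ x)]
  have hcomp : V ∘ φ =ᶠ[𝓝 x] (V ∘ (extChartAt (𝓡 m) (φ x)).symm) ∘ localRep φ x :=
    (eventuallyEq_symm_comp_localRep hφ.continuousAt).fun_comp V
  rw [hcomp.fderiv_eq, fderiv_comp x hVs hu]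
  exact (DFunLike.congr_fun (chartMetric_riemGradient g V (φ x)) _).symm

theorem energyDensity_eq (V : N → ℝ) (φ : Euc n → N) : energyDensity g V φ = fun z =>
    1 / 2 * ∑ i, pullbackMetric g φ z (EuclideanSpace.basisFun (Fin n) ℝ i)
      (EuclideanSpace.basisFun (Fin n) ℝ i) - (V ∘ φ) z := by
  funext z
  simp only [EuclideanSpace.basisFun_apply]
  rfl

theorem contDiff_pullbackMetric (hφ : ContMDiff (𝓡 n) (𝓡 m) 2 φ) :
    ContDiff ℝ 1 (pullbackMetric g φ) :=
  contDiffOn_univ.1 (contDiffOn_pullbackMetric g isOpen_univ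
    (one_add_one_eq_two.trans_le ENat.LEInfty.out) hφ.contMDiffOn)

theorem contDiff_energyDensity (hV : ContMDiff (𝓡 m) 𝓘(ℝ, ℝ) 1 V)
    (hφ : ContMDiff (𝓡 n) (𝓡 m) 2 φ) : ContDiff ℝ 1 (energyDensity g V φ) := by
  rw [energyDensity_eq]
  exact (contDiff_const.mul (ContDiff.sum fun i _ => ((contDiff_pullbackMetric g hφ).clm_apply
    contDiff_const).clm_apply contDiff_const)).sub
      (hV.comp (hφ.of_le one_le_two)).contDiff

theorem fderiv_energyDensity (hB : DifferentiableAt ℝ (pullbackMetric g φ) x)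
    (hVφ : DifferentiableAt ℝ (V ∘ φ) x) (v : Euc n) :
    fderiv ℝ (energyDensity g V φ) x v
      = 1 / 2 * ∑ i, fderiv ℝ (pullbackMetric g φ) x v (EuclideanSpace.basisFun (Fin n) ℝ i)
        (EuclideanSpace.basisFun (Fin n) ℝ i) - fderiv ℝ (V ∘ φ) x v := by
  have hterm (w : Euc n) : HasFDerivAt (fun z => pullbackMetric g φ z w w)
      (fderiv ℝ (fun z => pullbackMetric g φ z w w) x) x :=
    ((hB.clm_apply (differentiableAt_const w)).clm_apply (differentiableAt_const w)).hasFDerivAt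
  have h := ((HasFDerivAt.fun_sum (u := Finset.univ) fun i _ =>
    hterm (EuclideanSpace.basisFun (Fin n) ℝ i)).const_mul (1 / 2)).fun_sub hVφ.hasFDerivAt
  rw [energyDensity_eq]
  simp only [← fderiv_apply_apply_eq hB]
  rw [h.fderiv, sub_apply, smul_apply, sum_apply, smul_eq_mul]

theorem sum_fderiv_pullbackMetric_eq_fderiv_energyDensity (hV : ContMDiff (𝓡 m) 𝓘(ℝ, ℝ) 1 V)
    (hφ : ContMDiff (𝓡 n) (𝓡 m) 2 φ) (heq : tensionField g φ x = -riemGradient g V (φ x))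
    (v : Euc n) :
    ∑ i, fderiv ℝ (pullbackMetric g φ) x (EuclideanSpace.basisFun (Fin n) ℝ i)
        (EuclideanSpace.basisFun (Fin n) ℝ i) v
      = fderiv ℝ (energyDensity g V φ) x v := by
  have hB : DifferentiableAt ℝ (pullbackMetric g φ) x :=
    (contDiff_pullbackMetric g hφ).contDiffAt.differentiableAt one_ne_zero
  have hφ1 := (hφ.of_le one_le_two) x
  have hVφ : DifferentiableAt ℝ (V ∘ φ) x :=
    ((hV _).comp x hφ1).contDiffAt.differentiableAt one_ne_zero
  have hpull := pullbackMetric_eventuallyEq g hφ1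
  have hpotential : fderiv ℝ (V ∘ φ) x v
      = -((chartMetric g (φ x) (localRep φ x x) (Laplacian.laplacian (localRep φ x) x)
        + ∑ i, christoffelFirst (chartMetric g (φ x)) (localRep φ x x)
          (fderiv ℝ (localRep φ x) x (EuclideanSpace.basisFun (Fin n) ℝ i))
          (fderiv ℝ (localRep φ x) x (EuclideanSpace.basisFun (Fin n) ℝ i)))
        (fderiv ℝ (localRep φ x) x v)) := by
    simp only [EuclideanSpace.basisFun_apply]
    rw [← chartMetric_tensionField g (hφ x), heq,
      fderiv_comp_eq_chartMetric_riemGradient g ((hV _).mdifferentiableAt one_ne_zero) hφ1]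
    exact (neg_eq_iff_eq_neg.2 (DFunLike.congr_fun (map_neg _ _) _)).symm
  rw [fderiv_energyDensity g hB hVφ, hpotential, hpull.fderiv_eq,
    sum_fderiv_pullbackForm (EuclideanSpace.basisFun (Fin n) ℝ)
      ((contDiffAt_chartMetric g (mem_extChartAt_target (φ x))).of_le (by simp))
      (chartMetric_symm g) (contDiffAt_localRep ENat.LEInfty.out (hφ x)), sub_neg_eq_add]

theorem sum_pullbackMetric_eq (V : N → ℝ) (φ : Euc n → N) (y : Euc n) :
    ∑ i, pullbackMetric g φ y (EuclideanSpace.basisFun (Fin n) ℝ i)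
      (EuclideanSpace.basisFun (Fin n) ℝ i) = 2 * (energyDensity g V φ y + V (φ y)) := by
  simp only [energyDensity_eq, Function.comp_apply]
  ring

theorem scaledEnergy_eq (V : N → ℝ) (φ : Euc n → N) (x : Euc n) : scaledEnergy g V φ x =
    fun r => r ^ ((2 : ℤ) - finrank ℝ (Euc n)) • ∫ y in ball x r, energyDensity g V φ y := by
  funext r
  rw [scaledEnergy, finrank_euclideanSpace_fin, one_div, ← zpow_neg, neg_sub, smul_eq_mul]

end EnergyDensity

end HarmonicMap

open HarmonicMap in
theorem mainTheorem7_general {n m : ℕ} {N : Type*} [TopologicalSpace N] [ChartedSpace (Euc m) N]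
    [IsManifold (𝓡 m) ∞ N] (g : SmoothMetric m N)
    (V : N → ℝ) (hV : ContMDiff (𝓡 m) 𝓘(ℝ, ℝ) 1 V)
    (φ : Euc n → N) (hφ : ContMDiff (𝓡 n) (𝓡 m) 2 φ)
    (hτ : ∀ y, tensionField g φ y = -riemGradient g V (φ y))
    (hVφ : ∀ y, V (φ y) ≤ 0) (x : Euc n) :
    (∀ r : ℝ, 0 < r →
      MeasureTheory.IntegrableOn (energyDensity g V φ) (Metric.ball x r) ∧
      DifferentiableAt ℝ (scaledEnergy g V φ x) r ∧
      0 ≤ deriv (scaledEnergy g V φ x) r) ∧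
    MonotoneOn (scaledEnergy g V φ x) (Set.Ioi 0) := by
  have hsmooth := contDiff_energyDensity g hV hφ
  have hdiff (r : ℝ) (hr : 0 < r) : DifferentiableAt ℝ (scaledEnergy g V φ x) r := by
    rw [scaledEnergy_eq]
    exact (hasDerivAt_zpow_smul_setIntegral_ball _ hsmooth 2 x hr).differentiableAt
  have hderiv (r : ℝ) (hr : 0 < r) : 0 ≤ deriv (scaledEnergy g V φ x) r := by
    rw [scaledEnergy_eq]
    exact deriv_zpow_smul_setIntegral_ball_nonneg (EuclideanSpace.basisFun (Fin n) ℝ) _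
      (contDiff_pullbackMetric g hφ) (pullbackMetric_self_nonneg g φ) hsmooth
      (fun y => sum_fderiv_pullbackMetric_eq_fderiv_energyDensity g hV hφ (hτ y))
      (fun y => by rw [sum_pullbackMetric_eq g V φ y]; push_cast; linarith [hVφ y]) hr
  refine ⟨fun r hr => ⟨integrableOn_ball_of_continuous _ hsmooth.continuous x r, hdiff r hr,
    hderiv r hr⟩, monotoneOn_of_deriv_nonneg (convex_Ioi 0) ?_ ?_ ?_⟩
  · exact fun r hr => (hdiff r hr).continuousAt.continuousWithinAt
  · exact fun r hr => (hdiff r (interior_subset hr)).differentiableWithinAt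
  · exact fun r hr => hderiv r (interior_subset hr)

theorem mainTheorem7 {n m : ℕ} {N : Type*} [TopologicalSpace N] [ChartedSpace (Euc m) N]
    [IsManifold (𝓡 m) ∞ N] (g : SmoothMetric m N)
    (V : N → ℝ) (hV : ContMDiff (𝓡 m) 𝓘(ℝ, ℝ) ∞ V)
    (φ : Euc n → N) (hφ : HarmonicMap.IsHarmonicWithPotential g V φ)
    (hVφ : ∀ y, V (φ y) ≤ 0) (x : Euc n) :
    (∀ r : ℝ, 0 < r →
      MeasureTheory.IntegrableOn (HarmonicMap.energyDensity g V φ) (Metric.ball x r) ∧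
      DifferentiableAt ℝ (HarmonicMap.scaledEnergy g V φ x) r ∧
      0 ≤ deriv (HarmonicMap.scaledEnergy g V φ x) r) ∧
    MonotoneOn (HarmonicMap.scaledEnergy g V φ x) (Set.Ioi 0) :=
  mainTheorem7_general g V (hV.of_le ENat.LEInfty.out) φ (hφ.smooth.of_le ENat.LEInfty.out)
    hφ.equation hVφ x
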